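/- Let $p\in[1,2)$, let $E=\ell^p(\mathbb N)$ be the real sequence space with canonical basis $(e_n)_{n\ge 0}$ and continuous dual $E^*$, and let $(\omega_n)_{n\ge 0}$ be a bounded sequence of positive weights. Let $\lambda_0>0$ and $$\lambda_n:=\lambda_0\prod_{l=0}^{n-1}\frac1{\omega_l},\qquad n\ge 0,$$ and assume that $(\lambda_n)_{n\ge 0}\in\ell^p(\mathbb N)$. Put $$\hat x:=\sum_{n\ge 0}\lambda_n e_n,\qquad \kappa(z):=\mathbf 1_{\{\|z\|\le \max_{n\ge 0}\lambda_n\}},\qquad \lambda(dz):=\sum_{n\ge 0}\delta_{\lambda_n e_n}(dz).$$ Then $\lambda$ is a Lévy measure on $E$ (that is, $\lambda(\{0\})=0$ and $\int_E\min(1,\langle z,x^*\rangle^2)\,\lambda(dz)<\infty$ for all $x^*\in E^*$), and there is a unique Borel probability measure $\mu$ on $E$ (the compound Poisson measure) with $$\int_E e^{i\langle z,x^*\rangle}\mu(dz)=\exp\Big(i\langle\hat x,x^*\rangle+\int_E\big(e^{i\langle z,x^*\rangle}-1-i\kappa(z)\langle z,x^*\rangle\big)\lambda(dz)\Big),\qquad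 x^*\in E^*.$$ Let $$C^=_\mu(x^*,y^*):=\log\int_E e^{i\langle z,x^*-y^*\rangle}\mu(dz)-\log\int_E e^{i\langle z,x^*\rangle}\mu(dz)-\log\int_E e^{-i\langle z,y^*\rangle}\mu(dz)$$ be the codifference of $\mu$, where $x^*\mapsto\log\int_E e^{i\langle z,x^*\rangle}\mu(dz)$ denotes the unique continuous logarithm on $E^*$ of the characteristic functional that vanishes at $x^*=0$ (it exists). Let $T$ be the weighted backward shift, i.e. the bounded linear operator on $E$ with $Te_0=0$ and $Te_{n+1}=\omega_n e_n$ for $n\ge 0$. Then: 1. $T$ leaves $\mu$ invariant. 2. For every $n\ge 0$ the series $\sum_{l\ge 0}(\lambda_l\lambda_{l+n})^{p/2}$ converges and $$\sup_{x^*,y^*\in E^*\setminus\{0\}}\frac{|C^=_\mu(x^*,T^{*n}y^*)|}{\|x^*\|^{p/2}\|y^*\|^{p/2}}\le 2^{4-p}\sum_{l=0}^\infty(\lambda_l\lambda_{l+n})^{p/2}.$$ In particular, $T$ is (strongly) mixing, i.e. $\lim_{n\to\infty}\mu(A\cap T^{-n}B)=\mu(A)\mu(B)$ for all Borel sets $A,B\subset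 E$, provided that $\lim_{n\to\infty}\sum_{l=0}^\infty(\lambda_l\lambda_{l+n})^{p/2}=0$. -/

import Mathlib

open MeasureTheory Filter Topology
open scoped ENNReal

/-- A measurable map `T` is *(strongly) mixing* for `μ`: it preserves `μ`, and
`μ (A ∩ T⁻ⁿ B) → μ A * μ B` for all measurable sets `A`, `B`. -/
def IsMixing {E : Type*} [MeasurableSpace E] (T : E → E) (μ : Measure E) : Prop :=
  MeasurePreserving T μ μ ∧
    ∀ A B : Set E, MeasurableSet A → MeasurableSet B →
      Tendsto (fun n : ℕ => μ (A ∩ (T^[n]) ⁻¹' B)) atTop (𝓝 (μ A * μ B))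

section InfinitelyDivisible

variable {E : Type*} [NormedAddCommGroup E] [NormedSpace ℝ E] [MeasurableSpace E]

/-- Lévy measures on a real normed space: `Λ {0} = 0` and
`∫ min (1, ⟨z, x⟩²) Λ(dz) < ∞` for every continuous linear functional `x`. -/
def IsLevyMeasure (Λ : Measure E) : Prop :=
  Λ {0} = 0 ∧ ∀ x : StrongDual ℝ E, ∫⁻ z, ENNReal.ofReal (min 1 ((x z) ^ 2)) ∂Λ < ∞

/-- Truncation functions: bounded measurable functions `κ` with `κ z → 1` as `z → 0` and
`κ z = O(1 / ‖z‖)` as `‖z‖ → ∞`. -/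
structure IsTruncation (κ : E → ℝ) : Prop where
  measurable : Measurable κ
  bounded : ∃ C : ℝ, ∀ z, |κ z| ≤ C
  tendsto_zero : Tendsto κ (𝓝 0) (𝓝 1)
  isBigO_infty : κ =O[Bornology.cobounded E] fun z => 1 / ‖z‖

/-- `R : E* → E` is symmetric and positive semidefinite. -/
def IsCovariance (R : StrongDual ℝ E →L[ℝ] E) : Prop :=
  (∀ x y : StrongDual ℝ E, y (R x) = x (R y)) ∧ ∀ x : StrongDual ℝ E, 0 ≤ x (R x)

/-- `μ` is the infinitely divisible probability measure on the real Banach space `E` with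
covariance operator `R`, drift `b`, truncation function `κ` and Lévy measure `Λ`, that is,
`∫ exp (i⟨z, x⟩) μ(dz)
  = exp (- ⟨R x, x⟩ / 4 + i⟨b, x⟩ + ∫ (exp (i⟨z, x⟩) - 1 - i κ(z) ⟨z, x⟩) Λ(dz))`
for every `x` in `E*`, where the integrand on the right-hand side is integrable.
(`charFunDual μ x` is `∫ exp (i⟨z, x⟩) μ(dz)`.) -/
structure HasLevyKhintchine (μ : Measure E) (R : StrongDual ℝ E →L[ℝ] E) (b : E)
    (κ : E → ℝ) (Λ : Measure E) : Prop where
  isProbabilityMeasure : IsProbabilityMeasure μ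
  isCovariance : IsCovariance R
  isTruncation : IsTruncation κ
  isLevyMeasure : IsLevyMeasure Λ
  integrable : ∀ x : StrongDual ℝ E,
    Integrable (fun z => Complex.exp (Complex.I * x z) - 1 - Complex.I * κ z * x z) Λ
  charFun_eq : ∀ x : StrongDual ℝ E,
    charFunDual μ x = Complex.exp (-(1 / 4) * x (R x) + Complex.I * x b +
      ∫ z, (Complex.exp (Complex.I * x z) - 1 - Complex.I * κ z * x z) ∂Λ)

/-- `ψ` is the (distinguished) logarithm of the characteristic functional of `μ`: the continuous
function on `E*` with `ψ 0 = 0` and `exp (ψ x) = ∫ exp (i⟨z, x⟩) μ(dz)`. As `E*` is connected,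
there is at most one such function. The principal branch of the logarithm is not meant here:
it is not additive, so that it would not turn products of characteristic functionals into sums. -/
def IsLogCharFun (μ : Measure E) (ψ : StrongDual ℝ E → ℂ) : Prop :=
  Continuous ψ ∧ ψ 0 = 0 ∧ ∀ x, Complex.exp (ψ x) = charFunDual μ x

open Classical in
/-- The distinguished logarithm of the characteristic functional of `μ`
(with junk value `0` if there is none). -/
noncomputable def logCharFun (μ : Measure E) : StrongDual ℝ E → ℂ :=
  if h : ∃ ψ, IsLogCharFun μ ψ then h.choose else 0

/-- The codifference functional
`C^=_μ(x, y) = log ∫ e^{i⟨z, x - y⟩} dμ - log ∫ e^{i⟨z, x⟩} dμ - log ∫ e^{-i⟨z, y⟩} dμ`. -/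
noncomputable def codifference (μ : Measure E) (x y : StrongDual ℝ E) : ℂ :=
  logCharFun μ (x - y) - logCharFun μ x - logCharFun μ (-y)

end InfinitelyDivisible

/-- The real sequence space `ℓ^p(ℕ)`. -/
abbrev RealSeq (p : ℝ≥0∞) : Type := lp (fun _ : ℕ => ℝ) p

section Shift

variable (p : ℝ≥0∞) [Fact (1 ≤ p)]

/-- The canonical basis vector `e_n` of `ℓ^p(ℕ)`. -/
noncomputable def basisVec (n : ℕ) : RealSeq p := lp.single p n (1 : ℝ)

variable {p} in
theorem memℓp_shift (ω : ℕ → ℝ) (hω : BddAbove (Set.range fun n => |ω n|)) (x : RealSeq p) :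
    Memℓp (fun n => ω n * x (n + 1)) p := by
  obtain ⟨C, hC⟩ := hω
  have hC' : ∀ n, |ω n| ≤ C := fun n => hC ⟨n, rfl⟩
  have hC0 : 0 ≤ C := (abs_nonneg _).trans (hC' 0)
  rcases eq_or_ne p ∞ with rfl | hp
  · refine memℓp_infty ⟨C * ‖x‖, ?_⟩
    rintro _ ⟨n, rfl⟩
    simp only [norm_mul, Real.norm_eq_abs]
    exact mul_le_mul (hC' n) (lp.norm_apply_le_norm ENNReal.top_ne_zero x (n + 1))
      (abs_nonneg _) hC0
  · have hp0 : 0 < p.toReal :=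
      ENNReal.toReal_pos (zero_lt_one.trans_le (Fact.out : 1 ≤ p)).ne' hp
    apply memℓp_gen
    have hs : Summable fun n => C ^ p.toReal * ‖x (n + 1)‖ ^ p.toReal :=
      ((summable_nat_add_iff 1).2 ((lp.memℓp x).summable hp0)).mul_left _
    refine Summable.of_nonneg_of_le (fun n => by positivity) (fun n => ?_) hs
    rw [norm_mul, Real.mul_rpow (norm_nonneg _) (norm_nonneg _)]
    gcongr
    exact hC' n

variable {p} in
theorem norm_shift_le (ω : ℕ → ℝ) (hω : BddAbove (Set.range fun n => |ω n|)) (x : RealSeq p) :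
    ‖(⟨fun n => ω n * x (n + 1), memℓp_shift ω hω x⟩ : RealSeq p)‖ ≤
      (⨆ n, |ω n|) * ‖x‖ := by
  have hC' : ∀ n, |ω n| ≤ ⨆ n, |ω n| := fun n => le_ciSup hω n
  have hC0 : 0 ≤ ⨆ n, |ω n| := (abs_nonneg _).trans (hC' 0)
  rcases eq_or_ne p ∞ with rfl | hp
  · refine lp.norm_le_of_forall_le (by positivity) fun n => ?_
    change ‖ω n * x (n + 1)‖ ≤ _
    rw [norm_mul, Real.norm_eq_abs]
    exact mul_le_mul (hC' n) (lp.norm_apply_le_norm ENNReal.top_ne_zero x (n + 1))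
      (norm_nonneg _) hC0
  · have hp0 : 0 < p.toReal :=
      ENNReal.toReal_pos (zero_lt_one.trans_le (Fact.out : 1 ≤ p)).ne' hp
    refine lp.norm_le_of_forall_sum_le hp0 (by positivity) fun s => ?_
    change ∑ n ∈ s, ‖ω n * x (n + 1)‖ ^ p.toReal ≤ _
    rw [Real.mul_rpow hC0 (norm_nonneg _)]
    calc ∑ n ∈ s, ‖ω n * x (n + 1)‖ ^ p.toReal
        ≤ ∑ n ∈ s, (⨆ n, |ω n|) ^ p.toReal * ‖x (n + 1)‖ ^ p.toReal := by
          refine Finset.sum_le_sum fun n _ => ?_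
          rw [norm_mul, Real.mul_rpow (norm_nonneg _) (norm_nonneg _)]
          gcongr
          exact hC' n
      _ = (⨆ n, |ω n|) ^ p.toReal *
            ∑ n ∈ s.map (addRightEmbedding 1), ‖x n‖ ^ p.toReal := by
          rw [Finset.sum_map, Finset.mul_sum]
          rfl
      _ ≤ (⨆ n, |ω n|) ^ p.toReal * ‖x‖ ^ p.toReal := by
          gcongr
          exact lp.sum_rpow_le_norm_rpow hp0 x _

/-- The weighted backward shift on `ℓ^p(ℕ)` with bounded weights `ω`, in coordinates
`(T x)_n = ω_n x_{n+1}`; equivalently, `T e_0 = 0` and `T e_{n+1} = ω_n e_n` (see below). -/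
noncomputable def weightedBackwardShift (ω : ℕ → ℝ) (hω : BddAbove (Set.range fun n => |ω n|)) :
    RealSeq p →L[ℝ] RealSeq p :=
  LinearMap.mkContinuous
    { toFun := fun x => ⟨fun n => ω n * x (n + 1), memℓp_shift ω hω x⟩
      map_add' := fun x y => by
        ext n
        change ω n * (x (n + 1) + y (n + 1)) = ω n * x (n + 1) + ω n * y (n + 1)
        ring
      map_smul' := fun c x => by
        ext n
        change ω n * (c * x (n + 1)) = c * (ω n * x (n + 1))
        ring }
    (⨆ n, |ω n|) (norm_shift_le ω hω)

theorem weightedBackwardShift_apply (ω : ℕ → ℝ) (hω : BddAbove (Set.range fun n => |ω n|))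
    (x : RealSeq p) (n : ℕ) : weightedBackwardShift p ω hω x n = ω n * x (n + 1) := rfl

theorem weightedBackwardShift_basisVec_zero (ω : ℕ → ℝ)
    (hω : BddAbove (Set.range fun n => |ω n|)) :
    weightedBackwardShift p ω hω (basisVec p 0) = 0 := by
  ext n
  simp [weightedBackwardShift_apply, basisVec]

theorem weightedBackwardShift_basisVec_succ (ω : ℕ → ℝ)
    (hω : BddAbove (Set.range fun n => |ω n|)) (n : ℕ) :
    weightedBackwardShift p ω hω (basisVec p (n + 1)) = ω n • basisVec p n := by
  ext m
  rw [weightedBackwardShift_apply]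
  rcases eq_or_ne m n with rfl | h
  · simp [basisVec]
  · simp [basisVec, h]

end Shift

/-- `λ_n = λ_0 ∏_{l < n} 1 / ω_l`. -/
noncomputable def shiftCoeff (lam0 : ℝ) (ω : ℕ → ℝ) (n : ℕ) : ℝ :=
  lam0 * ∏ l ∈ Finset.range n, 1 / ω l

section CompoundPoisson

variable (p : ℝ≥0∞) [Fact (1 ≤ p)] [MeasurableSpace (RealSeq p)]

/-- The measure `∑ n, δ_{λ_n e_n}` on `ℓ^p(ℕ)`. -/
noncomputable def poissonLevyMeasure (lam : ℕ → ℝ) : Measure (RealSeq p) :=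
  Measure.sum fun n => Measure.dirac (lam n • basisVec p n)

/-- The truncation function `κ(z) = 1_{‖z‖ ≤ max_n λ_n}` on `ℓ^p(ℕ)`. -/
noncomputable def poissonTruncation (lam : ℕ → ℝ) : RealSeq p → ℝ :=
  Set.indicator {z | ‖z‖ ≤ ⨆ n, lam n} 1

/-- `μ` is the compound Poisson measure on `ℓ^p(ℕ)` with `R = 0`, drift `∑ n, λ_n e_n` (the
sequence `λ` itself, as an element of `ℓ^p(ℕ)`), truncation function `1_{‖z‖ ≤ max_n λ_n}` and
Lévy measure `∑ n, δ_{λ_n e_n}`. -/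
def IsCompoundPoisson (lam : ℕ → ℝ) (hlam : Memℓp lam p) (μ : Measure (RealSeq p)) : Prop :=
  HasLevyKhintchine μ 0 (⟨lam, hlam⟩ : RealSeq p) (poissonTruncation p lam)
    (poissonLevyMeasure p lam)

end CompoundPoisson

/-! Let `N_n` be independent Poisson variables of rate one and `Z(N) = ∑ λ_n N_n e_n`. Since `E ∑
λ_n^p N_n^p < ∞`, the series lies in `ℓ^p` almost surely. Its characteristic functional is the
exponential of `∑ (exp (i λ_n ⟨e_n, x⟩) - 1)`, which is the Lévy-Khintchine exponent because `κ = 1`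
on every atom, so that the compensator cancels the drift. Hence `μ` is the law of `Z`, and it is
unique because a characteristic functional determines a finite Borel measure on a separable Banach
space.

The recursion `ω_n λ_{n+1} = λ_n` gives `T (Z N) = Z (shift N)`: `T` is a factor of a Bernoulli
shift, whence invariance and mixing (`isMixing_seqShift`, `IsMixing.map`).

The codifference is `∑ (e^{i s_k} - 1)(e^{-i t_k} - 1)` (`hasSum_codifference`). For `T^{*n} y` the
terms `k < n` vanish, and interpolating `|e^{it} - 1|` between `2` and `|t|` bounds the others, even
with `2^{2-p}` (`norm_codifference_le`). -/

/-! ### Mixing of Bernoulli shifts and of their factors. -/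

section Mixing

/-- The one-sided shift on sequences. -/
def seqShift {X : Type*} (N : ℕ → X) : ℕ → X := fun i => N (i + 1)

theorem seqShift_iterate_apply {X : Type*} (n : ℕ) (N : ℕ → X) (i : ℕ) :
    seqShift^[n] N i = N (i + n) := by
  induction n generalizing N with
  | zero => rfl
  | succ n ih =>
    rw [Function.iterate_succ_apply, ih, seqShift]
    congr 1

variable {X : Type*} [MeasurableSpace X] (ν : Measure X) [IsProbabilityMeasure ν]

theorem measurePreserving_seqShift :
    MeasurePreserving seqShift (Measure.infinitePi fun _ : ℕ => ν)
      (Measure.infinitePi fun _ : ℕ => ν) where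
  measurable := measurable_pi_lambda _ fun _ => measurable_pi_apply _
  map_eq := Measure.map_infinitePi_infinitePi_of_inj (P := fun _ : ℕ => ν)
    (add_left_injective 1)

/-- Under an i.i.d. law, cylinder sets are independent of the distant future. -/
theorem measure_cylinder_inter_seqShift {A B : Set (ℕ → X)} (hA : A ∈ measurableCylinders fun _ => X)
    (hB : MeasurableSet B) :
    ∀ᶠ n in atTop, (Measure.infinitePi fun _ : ℕ => ν) (A ∩ seqShift^[n] ⁻¹' B) =
      (Measure.infinitePi fun _ : ℕ => ν) A * (Measure.infinitePi fun _ : ℕ => ν) B := by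
  obtain ⟨s, U, hU, rfl⟩ := (mem_measurableCylinders _).1 hA
  obtain ⟨M, hM⟩ := s.exists_nat_subset_range
  filter_upwards [eventually_ge_atTop M] with n hn
  -- By invariance the goal becomes independence of the coordinates in `s` from those with index at
  -- least `n`.
  rw [← ((measurePreserving_seqShift ν).iterate n).measure_preimage hB.nullMeasurableSet]
  have hind : ProbabilityTheory.iIndep
      (fun i : ℕ => MeasurableSpace.comap (fun N : ℕ → X => N i) inferInstance)
      (Measure.infinitePi fun _ : ℕ => ν) :=
    ProbabilityTheory.iIndepFun_infinitePi (P := fun _ : ℕ => ν)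
      (X := fun (_ : ℕ) (x : X) => x) fun _ => measurable_id
  have hdisj : Disjoint (s : Set ℕ) (Set.Ici n) := Set.disjoint_left.2 fun i hi hi' => by
    have := Finset.mem_range.1 (hM hi)
    have := Set.mem_Ici.1 hi'
    omega
  have := ProbabilityTheory.indep_iSup_of_disjoint (fun i => (measurable_pi_apply i).comap_le)
    hind hdisj
  refine (ProbabilityTheory.Indep_iff _ _ _).1 this _ _ ?_ ?_
  · refine @measurable_pi_lambda _ _ _ (_) _ _ (fun i => ?_) _ hU
    exact (comap_measurable _).mono (le_iSup₂_of_le (i : ℕ) i.2 le_rfl) le_rfl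
  · refine @measurable_pi_lambda _ _ _ (_) _ _ (fun i => ?_) _ hB
    simp only [seqShift_iterate_apply]
    exact (comap_measurable _).mono (le_iSup₂_of_le (i + n) (Nat.le_add_left n i) le_rfl) le_rfl

/-- Bernoulli shifts are mixing. -/
theorem isMixing_seqShift : IsMixing seqShift (Measure.infinitePi fun _ : ℕ => ν) := by
  refine ⟨measurePreserving_seqShift ν, fun A B hA hB => ?_⟩
  set P := Measure.infinitePi fun _ : ℕ => ν
  have hpre (n : ℕ) : MeasurableSet (seqShift^[n] ⁻¹' B) :=
    ((measurePreserving_seqShift ν).iterate n).measurable hB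
  have hBn (n : ℕ) : P (seqShift^[n] ⁻¹' B) = P B :=
    ((measurePreserving_seqShift ν).iterate n).measure_preimage hB.nullMeasurableSet
  -- With real values, complements become subtraction and disjoint unions become series open to
  -- dominated convergence. `B` stays fixed in the π-λ induction on `A`.
  suffices h : Tendsto (fun n : ℕ => P.real (A ∩ seqShift^[n] ⁻¹' B)) atTop
      (𝓝 (P.real A * P.real B)) by
    rw [← ENNReal.tendsto_toReal_iff (fun _ => measure_ne_top _ _)
      (ENNReal.mul_ne_top (measure_ne_top _ _) (measure_ne_top _ _)), ENNReal.toReal_mul]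
    exact h
  induction A, hA using
    MeasurableSpace.induction_on_inter generateFrom_measurableCylinders.symm
      isPiSystem_measurableCylinders with
  | empty => simp
  | basic t ht =>
    refine tendsto_const_nhds.congr' ?_
    filter_upwards [measure_cylinder_inter_seqShift ν ht hB] with n hn
    simp only [measureReal_def, P, hn, ENNReal.toReal_mul]
  | compl t ht ih =>
    have h1 (n : ℕ) : P.real (tᶜ ∩ seqShift^[n] ⁻¹' B) =
        P.real B - P.real (t ∩ seqShift^[n] ⁻¹' B) := by
      have := measureReal_inter_add_sdiff₀ (μ := P) (s := seqShift^[n] ⁻¹' B) ht.nullMeasurableSet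
      rw [measureReal_def P (seqShift^[n] ⁻¹' B), hBn, Set.inter_comm, ← measureReal_def,
        Set.sdiff_eq, Set.inter_comm _ tᶜ] at this
      linarith
    simp only [h1, probReal_compl_eq_one_sub ht, sub_mul, one_mul]
    exact ih.const_sub _
  | iUnion f hd hf ih =>
    have h1 (C : Set (ℕ → X)) (hC : MeasurableSet C) :
        HasSum (fun i => P.real (f i ∩ C)) (P.real ((⋃ i, f i) ∩ C)) := by
      have h := measure_iUnion (μ := P) (f := fun i => f i ∩ C)
        (fun i j hij => (hd hij).mono Set.inter_subset_left Set.inter_subset_left)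
        fun i => (hf i).inter hC
      rw [Set.iUnion_inter, measureReal_def, h,
        ENNReal.tsum_toReal_eq fun i => measure_ne_top P (f i ∩ C)]
      exact ENNReal.hasSum_toReal (h ▸ measure_ne_top _ _)
    have h2 : HasSum (fun i => P.real (f i)) (P.real (⋃ i, f i)) := by
      simpa using h1 _ MeasurableSet.univ
    rw [← h2.tsum_eq, ← tsum_mul_right]
    simp only [← fun n => (h1 _ (hpre n)).tsum_eq]
    refine tendsto_tsum_of_dominated_convergence h2.summable ih (Eventually.of_forall fun n i => ?_)
    rw [Real.norm_of_nonneg measureReal_nonneg]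
    exact measureReal_mono Set.inter_subset_left

/-- A measurable factor of a mixing system is mixing. -/
theorem IsMixing.map {X Y : Type*} [MeasurableSpace X] [MeasurableSpace Y] {P : Measure X}
    {S : X → X} {T : Y → Y} {Z : X → Y} (hS : IsMixing S P) (hT : Measurable T)
    (hZ : Measurable Z) (hconj : ∀ᵐ x ∂P, T (Z x) = Z (S x)) : IsMixing T (P.map Z) := by
  refine ⟨⟨hT, ?_⟩, fun A B hA hB => ?_⟩
  · rw [Measure.map_map hT hZ, Measure.map_congr (f := T ∘ Z) (g := Z ∘ S) hconj,
      ← Measure.map_map hZ hS.1.measurable, hS.1.map_eq]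
  · have hiter (n : ℕ) : ∀ᵐ x ∂P, T^[n] (Z x) = Z (S^[n] x) := by
      induction n with
      | zero => simp
      | succ n ih =>
        filter_upwards [ih, (hS.1.iterate n).quasiMeasurePreserving.ae hconj] with x h1 h2
        rw [Function.iterate_succ_apply', h1, h2, Function.iterate_succ_apply']
    have h1 (n : ℕ) : P.map Z (A ∩ T^[n] ⁻¹' B) = P (Z ⁻¹' A ∩ S^[n] ⁻¹' (Z ⁻¹' B)) := by
      rw [Measure.map_apply hZ (hA.inter (hT.iterate n hB))]
      refine measure_congr ?_
      filter_upwards [hiter n] with x hx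
      exact congrArg (fun y => Z x ∈ A ∧ y ∈ B) hx
    simp only [h1, Measure.map_apply hZ hA, Measure.map_apply hZ hB]
    exact hS.2 _ _ (hZ hA) (hZ hB)

end Mixing

/-! ### Basis expansions and duality in `ℓ^p`. -/

section SequenceSpace

variable {p : ℝ≥0∞} [Fact (1 ≤ p)]

theorem toReal_pos_of_ne_top (hp : p ≠ ∞) : 0 < p.toReal :=
  ENNReal.toReal_pos (zero_lt_one.trans_le (Fact.out : 1 ≤ p)).ne' hp

theorem norm_basisVec (n : ℕ) : ‖basisVec p n‖ = 1 := by
  rw [basisVec, lp.norm_single (zero_lt_one.trans_le (Fact.out : 1 ≤ p)), norm_one]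

theorem norm_smul_basisVec (n : ℕ) (c : ℝ) : ‖c • basisVec p n‖ = |c| := by
  rw [norm_smul, norm_basisVec, mul_one, Real.norm_eq_abs]

omit [Fact (1 ≤ p)] in
theorem bddAbove_range_of_memℓp {lam : ℕ → ℝ} (hlam : Memℓp lam p) :
    BddAbove (Set.range lam) := by
  obtain ⟨C, hC⟩ := (hlam.of_exponent_ge le_top).bddAbove
  exact ⟨C, by rintro _ ⟨n, rfl⟩; exact (le_abs_self _).trans (hC ⟨n, rfl⟩)⟩

theorem abs_apply_basisVec_le (x : StrongDual ℝ (RealSeq p)) (n : ℕ) :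
    |x (basisVec p n)| ≤ ‖x‖ := by
  simpa [norm_basisVec] using x.le_opNorm (basisVec p n)

omit [Fact (1 ≤ p)] in
theorem single_eq_smul_basisVec (n : ℕ) (c : ℝ) :
    (lp.single p n c : RealSeq p) = c • basisVec p n := by
  rw [basisVec, ← lp.single_smul, smul_eq_mul, mul_one]

theorem hasSum_smul_basisVec (hp : p ≠ ∞) (a : RealSeq p) :
    HasSum (fun n => a n • basisVec p n) a := by
  simpa only [single_eq_smul_basisVec] using lp.hasSum_single hp a

theorem hasSum_mul_apply_basisVec (hp : p ≠ ∞) (a : RealSeq p) (x : StrongDual ℝ (RealSeq p)) :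
    HasSum (fun n => a n * x (basisVec p n)) (x a) := by
  simpa using (hasSum_smul_basisVec hp a).mapL x

/-- The countable basis has dense span. Separability makes sums of Borel maps measurable and lets
characteristic functionals determine measures. -/
theorem secondCountableTopology_realSeq (hp : p ≠ ∞) :
    SecondCountableTopology (RealSeq p) := by
  have : TopologicalSpace.SeparableSpace (RealSeq p) := by
    rw [← TopologicalSpace.isSeparable_univ_iff]
    refine ((Set.countable_range (basisVec p)).isSeparable.span (R := ℝ)).closure.mono fun a _ => ?_
    refine mem_closure_of_tendsto (hasSum_smul_basisVec hp a) (Eventually.of_forall fun s => ?_)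
    exact Submodule.sum_mem _ fun n _ =>
      Submodule.smul_mem _ _ (Submodule.subset_span ⟨n, rfl⟩)
  exact UniformSpace.secondCountable_of_separable _

theorem summable_abs_mul_apply_basisVec (hp : p ≠ ∞) (a : RealSeq p)
    (x : StrongDual ℝ (RealSeq p)) :
    Summable fun n => |a n * x (basisVec p n)| :=
  (hasSum_mul_apply_basisVec hp a x).summable.abs

/-- Changing the signs of the coordinates of `a` does not increase its norm and turns the series of
`x` into the series of absolute values; no description of the dual as `ℓ^q` is needed. -/
theorem tsum_abs_mul_apply_basisVec_le (hp : p ≠ ∞) (a : RealSeq p)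
    (x : StrongDual ℝ (RealSeq p)) :
    ∑' n, |a n * x (basisVec p n)| ≤ ‖x‖ * ‖a‖ := by
  have hp0 := toReal_pos_of_ne_top hp
  let f : ℕ → ℝ := fun n => SignType.sign (a n * x (basisVec p n)) * a n
  have hle (n : ℕ) : ‖f n‖ ≤ ‖a n‖ := by
    simp only [f, norm_mul]
    refine mul_le_of_le_one_left (norm_nonneg _) ?_
    rcases SignType.sign (a n * x (basisVec p n)) with _ | _ | _ <;> simp
  have hf : Memℓp f p := by
    refine memℓp_gen (((lp.memℓp a).summable hp0).of_nonneg_of_le (fun n => by positivity)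
      fun n => ?_)
    gcongr
    exact hle n
  let b : RealSeq p := ⟨f, hf⟩
  have hb : ‖b‖ ≤ ‖a‖ := by
    refine lp.norm_le_of_forall_sum_le hp0 (norm_nonneg _) fun s => ?_
    refine le_trans (Finset.sum_le_sum fun n _ => ?_) (lp.sum_rpow_le_norm_rpow hp0 a s)
    gcongr
    exact hle n
  have hsum := hasSum_mul_apply_basisVec hp b x
  have heq : (fun n => b n * x (basisVec p n)) = fun n => |a n * x (basisVec p n)| := by
    ext n
    change SignType.sign (a n * x (basisVec p n)) * a n * x (basisVec p n) = _
    rw [mul_assoc, sign_mul_self]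
  rw [heq] at hsum
  rw [hsum.tsum_eq]
  calc x b ≤ ‖x b‖ := le_abs_self _
    _ ≤ ‖x‖ * ‖b‖ := x.le_opNorm b
    _ ≤ ‖x‖ * ‖a‖ := by gcongr

end SequenceSpace

/-! ### The Poisson exponent, distinguished logarithms and codifferences. -/

section Exponent

open Complex

variable {p : ℝ≥0∞} [Fact (1 ≤ p)]

/-- The exponent `∑ n, (exp (i λ_n ⟨e_n, x⟩) - 1)` of the law of `∑ n, λ_n N_n e_n`, where the
`N_n` are independent Poisson variables of rate one. -/
noncomputable def poissonExponent (a : RealSeq p) (x : StrongDual ℝ (RealSeq p)) : ℂ :=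
  ∑' n, (exp (I * (a n * x (basisVec p n) : ℝ)) - 1)

theorem summable_exp_sub_one {t : ℕ → ℝ} (ht : Summable fun n => |t n|) :
    Summable fun n => exp (I * t n) - 1 :=
  .of_norm_bounded ht fun _ => Real.norm_exp_I_mul_ofReal_sub_one_le

theorem hasSum_poissonExponent (hp : p ≠ ∞) (a : RealSeq p) (x : StrongDual ℝ (RealSeq p)) :
    HasSum (fun n => exp (I * (a n * x (basisVec p n) : ℝ)) - 1) (poissonExponent a x) :=
  (summable_exp_sub_one (summable_abs_mul_apply_basisVec hp a x)).hasSum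

theorem poissonExponent_zero (a : RealSeq p) : poissonExponent a 0 = 0 := by
  simp [poissonExponent]

theorem norm_exp_sub_exp_le (s t : ℝ) : ‖exp (I * s) - exp (I * t)‖ ≤ |s - t| := by
  have h : exp (I * s) - exp (I * t) = exp (I * t) * (exp (I * (s - t : ℝ)) - 1) := by
    rw [mul_sub, ← exp_add, mul_one]
    push_cast
    ring_nf
  rw [h, norm_mul, norm_exp_I_mul_ofReal, one_mul]
  exact Real.norm_exp_I_mul_ofReal_sub_one_le

/-- Termwise `|e^{is} - e^{it}| ≤ |s - t|` makes the exponent Lipschitz with constant `‖a‖`.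
Continuity is what makes it the distinguished logarithm. -/
theorem continuous_poissonExponent (hp : p ≠ ∞) (a : RealSeq p) :
    Continuous (poissonExponent a) := by
  refine (LipschitzWith.of_dist_le_mul (K := ‖a‖₊) fun x y => ?_).continuous
  rw [dist_eq_norm, dist_eq_norm, ← ((hasSum_poissonExponent hp a x).sub
    (hasSum_poissonExponent hp a y)).tsum_eq, coe_nnnorm, mul_comm]
  refine le_trans (tsum_of_norm_bounded (summable_abs_mul_apply_basisVec hp a (x - y)).hasSum
    fun n => ?_) (tsum_abs_mul_apply_basisVec_le hp a (x - y))
  rw [sub_sub_sub_cancel_right]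
  refine (norm_exp_sub_exp_le _ _).trans_eq ?_
  rw [← mul_sub, sub_apply]

/-- A continuous logarithm of the characteristic functional is unique. -/
theorem eq_of_continuous_of_exp_eq {E : Type*} [TopologicalSpace E] [PreconnectedSpace E]
    {f g : E → ℂ} (hf : Continuous f) (hg : Continuous g) {x₀ : E} (h₀ : f x₀ = g x₀)
    (h : ∀ x, exp (f x) = exp (g x)) : f = g := by
  have hex (x : E) : ∃ n : ℤ, f x = g x + n * (2 * Real.pi * I) := exp_eq_exp_iff_exists_int.1 (h x)
  choose k hk using hex
  have h2 : (2 * Real.pi * I : ℂ) ≠ 0 := two_pi_I_ne_zero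
  -- Two logarithms differ by `2πi k` with `k` integer-valued and continuous, hence constant on a
  -- connected space.
  have hkc : Continuous k := by
    rw [Int.isClosedEmbedding_coe_real.isEmbedding.continuous_iff]
    have : (Int.cast ∘ k : E → ℝ) = fun x => ((f x - g x) / (2 * Real.pi * I)).re := by
      ext x
      rw [hk, add_sub_cancel_left, mul_div_cancel_right₀ _ h2]
      simp
    rw [this]
    fun_prop
  ext x
  have h0 : k x₀ = 0 := by
    have := hk x₀
    rw [h₀, left_eq_add, mul_eq_zero] at this
    exact_mod_cast this.resolve_right h2
  rw [hk x, PreconnectedSpace.constant ‹_› hkc (x := x) (y := x₀), h0]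
  simp

section Log

variable [MeasurableSpace (RealSeq p)] {μ : Measure (RealSeq p)} {a : RealSeq p}

theorem isLogCharFun_logCharFun {E : Type*} [NormedAddCommGroup E] [NormedSpace ℝ E]
    [MeasurableSpace E] {μ : Measure E} {ψ : StrongDual ℝ E → ℂ} (h : IsLogCharFun μ ψ) :
    IsLogCharFun μ (logCharFun μ) := by
  have h' : ∃ ψ, IsLogCharFun μ ψ := ⟨ψ, h⟩
  rw [logCharFun, dif_pos h']
  exact h'.choose_spec

theorem logCharFun_eq {E : Type*} [NormedAddCommGroup E] [NormedSpace ℝ E]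
    [MeasurableSpace E] {μ : Measure E} {ψ : StrongDual ℝ E → ℂ} (h : IsLogCharFun μ ψ) :
    logCharFun μ = ψ := by
  obtain ⟨h1, h2, h3⟩ := isLogCharFun_logCharFun h
  exact eq_of_continuous_of_exp_eq h1 h.1 (h2.trans h.2.1.symm) fun x => (h3 x).trans (h.2.2 x).symm

theorem isLogCharFun_poissonExponent (hp : p ≠ ∞)
    (h : ∀ x, charFunDual μ x = exp (poissonExponent a x)) :
    IsLogCharFun μ (poissonExponent a) :=
  ⟨continuous_poissonExponent hp a, poissonExponent_zero a, fun x => (h x).symm⟩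

/-- With `u = e^{is}` and `v = e^{-it}`, this is `(uv - 1) - (u - 1) - (v - 1) = (u - 1)(v - 1)` in
each term. -/
theorem hasSum_codifference (hp : p ≠ ∞)
    (h : ∀ x, charFunDual μ x = exp (poissonExponent a x)) (x y : StrongDual ℝ (RealSeq p)) :
    HasSum (fun n => (exp (I * (a n * x (basisVec p n) : ℝ)) - 1) *
      (exp (I * (a n * (-y) (basisVec p n) : ℝ)) - 1)) (codifference μ x y) := by
  rw [codifference, logCharFun_eq (isLogCharFun_poissonExponent hp h)]
  refine (congrArg (HasSum · _) (funext fun n => ?_)).mpr (((hasSum_poissonExponent hp a (x - y)).sub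
    (hasSum_poissonExponent hp a x)).sub (hasSum_poissonExponent hp a (-y)))
  have : exp (I * (a n * (x - y) (basisVec p n) : ℝ)) =
      exp (I * (a n * x (basisVec p n) : ℝ)) * exp (I * (a n * (-y) (basisVec p n) : ℝ)) := by
    rw [← exp_add]
    congr 1
    simp only [sub_apply, neg_apply]
    push_cast
    ring
  rw [this]
  ring

end Log

/-- Interpolation between the bounds `2` and `|t|`. -/
theorem norm_exp_sub_one_le_rpow {θ : ℝ} (h0 : 0 ≤ θ) (h1 : θ ≤ 1) (t : ℝ) :
    ‖exp (I * t) - 1‖ ≤ 2 ^ (1 - θ) * |t| ^ θ := by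
  have hA : ‖exp (I * t) - 1‖ ≤ 2 := by
    refine (norm_sub_le _ _).trans_eq ?_
    rw [norm_exp_I_mul_ofReal, norm_one]
    norm_num
  have hB : ‖exp (I * t) - 1‖ ≤ |t| := Real.norm_exp_I_mul_ofReal_sub_one_le
  calc ‖exp (I * t) - 1‖
      = ‖exp (I * t) - 1‖ ^ (1 - θ) * ‖exp (I * t) - 1‖ ^ θ := by
        rw [← Real.rpow_add_of_nonneg (norm_nonneg _) (by linarith) h0, sub_add_cancel,
          Real.rpow_one]
    _ ≤ 2 ^ (1 - θ) * |t| ^ θ := by gcongr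

end Exponent

/-! ### The Lévy-Khintchine data of the compound Poisson measure. -/

section LevyKhintchine

open Complex

variable {p : ℝ≥0∞} [Fact (1 ≤ p)] [MeasurableSpace (RealSeq p)] [BorelSpace (RealSeq p)]

theorem isTruncation_poissonTruncation {lam : ℕ → ℝ} (hlam : Memℓp lam p) (hpos : ∀ n, 0 < lam n) :
    IsTruncation (poissonTruncation p lam) := by
  set M := ⨆ n, lam n
  have hM : 0 < M := (hpos 0).trans_le (le_ciSup (bddAbove_range_of_memℓp hlam) 0)
  have h1 {z : RealSeq p} (hz : ‖z‖ ≤ M) : poissonTruncation p lam z = 1 :=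
    Set.indicator_of_mem (s := {z : RealSeq p | ‖z‖ ≤ M}) hz _
  refine ⟨?_, ⟨1, fun z => ?_⟩, ?_, ?_⟩
  · exact measurable_one.indicator (isClosed_le continuous_norm continuous_const).measurableSet
  · rw [poissonTruncation, Set.indicator_apply]
    split_ifs <;> simp
  · refine tendsto_const_nhds.congr' ?_
    filter_upwards [Metric.closedBall_mem_nhds (0 : RealSeq p) hM] with z hz
    exact (h1 (by simpa using hz)).symm
  · refine Asymptotics.IsBigO.of_bound 1 ?_
    filter_upwards [eventually_cobounded_le_norm (M + 1)] with z hz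
    have hz' : z ∉ {z : RealSeq p | ‖z‖ ≤ M} := fun h => by
      have : ‖z‖ ≤ M := h
      linarith
    rw [poissonTruncation, Set.indicator_of_notMem hz', norm_zero]
    positivity

-- The truncation radius is the largest norm of an atom, so no atom is cut off.
omit [MeasurableSpace (RealSeq p)] [BorelSpace (RealSeq p)] in
theorem poissonTruncation_smul_basisVec {lam : ℕ → ℝ} (hlam : Memℓp lam p)
    (hpos : ∀ n, 0 < lam n) (n : ℕ) : poissonTruncation p lam (lam n • basisVec p n) = 1 := by
  refine Set.indicator_of_mem ?_ _
  change ‖lam n • basisVec p n‖ ≤ _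
  rw [norm_smul_basisVec, abs_of_pos (hpos n)]
  exact le_ciSup (bddAbove_range_of_memℓp hlam) n

/-- As `min 1 t² ≤ |t|`, absolute summability of `λ_n ⟨e_n, x⟩` suffices. -/
theorem isLevyMeasure_poissonLevyMeasure (hp : p ≠ ∞) {lam : ℕ → ℝ} (hlam : Memℓp lam p)
    (hpos : ∀ n, 0 < lam n) : IsLevyMeasure (poissonLevyMeasure p lam) := by
  refine ⟨?_, fun x => ?_⟩
  · rw [poissonLevyMeasure, Measure.sum_apply _ (measurableSet_singleton 0)]
    refine ENNReal.tsum_eq_zero.2 fun n => ?_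
    have h0 : lam n • basisVec p n ≠ 0 := by
      rw [← norm_ne_zero_iff, norm_smul_basisVec, abs_of_pos (hpos n)]
      exact (hpos n).ne'
    simp [h0]
  · rw [poissonLevyMeasure, lintegral_sum_measure]
    simp only [lintegral_dirac, map_smul, smul_eq_mul]
    refine (ENNReal.tsum_le_tsum fun n => ENNReal.ofReal_le_ofReal ?_).trans_lt
      (summable_abs_mul_apply_basisVec hp ⟨lam, hlam⟩ x).tsum_ofReal_lt_top
    change min 1 ((lam n * x (basisVec p n)) ^ 2) ≤ |lam n * x (basisVec p n)|
    rw [← sq_abs]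
    rcases le_total |lam n * x (basisVec p n)| 1 with h | h
    · exact (min_le_right _ _).trans (by nlinarith [abs_nonneg (lam n * x (basisVec p n))])
    · exact (min_le_left _ _).trans h

omit [MeasurableSpace (RealSeq p)] [BorelSpace (RealSeq p)] in
theorem levyIntegrand_smul_basisVec {lam : ℕ → ℝ} (hlam : Memℓp lam p) (hpos : ∀ n, 0 < lam n)
    (x : StrongDual ℝ (RealSeq p)) (n : ℕ) :
    exp (I * x (lam n • basisVec p n)) - 1 -
      I * poissonTruncation p lam (lam n • basisVec p n) * x (lam n • basisVec p n) =
    (exp (I * (lam n * x (basisVec p n) : ℝ)) - 1) - I * (lam n * x (basisVec p n) : ℝ) := by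
  rw [poissonTruncation_smul_basisVec hlam hpos, map_smul, smul_eq_mul]
  push_cast
  ring

theorem integrable_levyIntegrand (hp : p ≠ ∞) {lam : ℕ → ℝ} (hlam : Memℓp lam p)
    (hpos : ∀ n, 0 < lam n) (x : StrongDual ℝ (RealSeq p)) :
    Integrable (fun z => exp (I * x z) - 1 - I * poissonTruncation p lam z * x z)
      (poissonLevyMeasure p lam) := by
  refine integrable_sum_measure (fun n => integrable_dirac (by simp)) ?_
  simp only [integral_dirac, levyIntegrand_smul_basisVec hlam hpos]
  have hs := summable_abs_mul_apply_basisVec hp ⟨lam, hlam⟩ x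
  refine (hs.mul_left 2).of_nonneg_of_le (fun _ => norm_nonneg _) fun n => ?_
  refine (norm_sub_le _ _).trans ?_
  rw [norm_mul, norm_I, one_mul, norm_real, two_mul]
  exact add_le_add_left Real.norm_exp_I_mul_ofReal_sub_one_le _

/-- Truncation and drift cancel in the Lévy-Khintchine exponent. -/
theorem levyExponent_eq (hp : p ≠ ∞) {lam : ℕ → ℝ} (hlam : Memℓp lam p)
    (hpos : ∀ n, 0 < lam n) (x : StrongDual ℝ (RealSeq p)) :
    -(1 / 4) * (x ((0 : StrongDual ℝ (RealSeq p) →L[ℝ] RealSeq p) x) : ℂ) +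
      I * x (⟨lam, hlam⟩ : RealSeq p) +
      ∫ z, (exp (I * x z) - 1 - I * poissonTruncation p lam z * x z) ∂poissonLevyMeasure p lam =
    poissonExponent ⟨lam, hlam⟩ x := by
  have h1 := hasSum_integral_measure (integrable_levyIntegrand hp hlam hpos x)
  simp only [integral_dirac, levyIntegrand_smul_basisVec hlam hpos] at h1
  have h2 := ((hasSum_ofReal.2 (hasSum_mul_apply_basisVec hp ⟨lam, hlam⟩ x)).mul_left I).add h1
  refine Eq.trans ?_ (h2.unique ((congrArg (HasSum · _) (funext fun n => ?_)).mpr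
    (hasSum_poissonExponent hp ⟨lam, hlam⟩ x)))
  · simp
    rfl
  · exact add_sub_cancel _ _

/-- All the other Lévy-Khintchine requirements hold automatically, so existence and uniqueness
concern the characteristic functional alone. -/
theorem isCompoundPoisson_iff (hp : p ≠ ∞) {lam : ℕ → ℝ} (hlam : Memℓp lam p)
    (hpos : ∀ n, 0 < lam n) (μ : Measure (RealSeq p)) :
    IsCompoundPoisson p lam hlam μ ↔ IsProbabilityMeasure μ ∧
      ∀ x, charFunDual μ x = exp (poissonExponent ⟨lam, hlam⟩ x) := by
  constructor
  · intro h
    exact ⟨h.isProbabilityMeasure, fun x =>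
      (h.charFun_eq x).trans (congrArg exp (levyExponent_eq hp hlam hpos x))⟩
  · rintro ⟨h1, h2⟩
    exact ⟨h1, ⟨by simp, by simp⟩, isTruncation_poissonTruncation hlam hpos,
      isLevyMeasure_poissonLevyMeasure hp hlam hpos, integrable_levyIntegrand hp hlam hpos,
      fun x => (h2 x).trans (congrArg exp (levyExponent_eq hp hlam hpos x).symm)⟩

end LevyKhintchine

/-! ### The random series `∑ λ_n N_n e_n` and its law. -/

section PoissonSeries

open ProbabilityTheory

/-- The law of a sequence of independent Poisson variables of rate one. -/
noncomputable abbrev poissonSeqLaw : Measure (ℕ → ℕ) :=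
  Measure.infinitePi fun _ : ℕ => poissonMeasure 1

theorem summable_poisson_mul_sq :
    Summable fun n : ℕ => Real.exp (-(1 : NNReal)) * (1 : NNReal) ^ n / n.factorial * (n : ℝ) ^ 2 := by
  refine ((Real.summable_pow_div_factorial 4).mul_left (Real.exp (-1))).of_nonneg_of_le
    (fun n => by positivity) fun n => ?_
  have h : (n : ℝ) ^ 2 ≤ 4 ^ n := by
    have : (n : ℝ) ≤ 2 ^ n := by exact_mod_cast Nat.lt_two_pow_self.le
    calc (n : ℝ) ^ 2 ≤ (2 ^ n) ^ 2 := by gcongr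
      _ = 4 ^ n := by rw [← pow_mul, mul_comm, pow_mul]; norm_num
  calc Real.exp (-(1 : NNReal)) * (1 : NNReal) ^ n / n.factorial * (n : ℝ) ^ 2
      = Real.exp (-1) * ((n : ℝ) ^ 2 / n.factorial) := by
        simp only [NNReal.coe_one, one_pow]
        ring
    _ ≤ Real.exp (-1) * (4 ^ n / n.factorial) := by gcongr

/-- On natural numbers `n^q ≤ n^2`, and the second moment is finite. -/
theorem integrable_rpow_poissonMeasure {q : ℝ} (h0 : 0 < q) (h2 : q ≤ 2) :
    Integrable (fun n : ℕ => (n : ℝ) ^ q) (poissonMeasure 1) := by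
  refine Integrable.mono' (g := fun n : ℕ => (n : ℝ) ^ 2) ?_
    measurable_from_nat.aestronglyMeasurable (ae_of_all _ fun n => ?_)
  · rw [integrable_poissonMeasure_iff]
    simpa using summable_poisson_mul_sq
  · rw [Real.norm_of_nonneg (by positivity)]
    rcases n.eq_zero_or_pos with rfl | hn
    · simp [h0.ne']
    · rw [← Real.rpow_natCast]
      exact Real.rpow_le_rpow_of_exponent_le (by exact_mod_cast hn) (by exact_mod_cast h2)

variable {p : ℝ≥0∞}

open Classical in
/-- The random vector `∑ n, λ_n N_n e_n`, set to `0` where the series does not converge. -/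
noncomputable def weightedSeq (p : ℝ≥0∞) (lam : ℕ → ℝ) (N : ℕ → ℕ) : RealSeq p :=
  if h : Memℓp (fun n => lam n * (N n : ℝ)) p then ⟨_, h⟩ else 0

theorem weightedSeq_apply {lam : ℕ → ℝ} {N : ℕ → ℕ} (h : Memℓp (fun n => lam n * (N n : ℝ)) p)
    (n : ℕ) : weightedSeq p lam N n = lam n * N n := by
  rw [weightedSeq, dif_pos h]

/-- In this form membership in `ℓ^p` is a measurable condition and is open to Tonelli. -/
theorem memℓp_iff_tsum_ne_top (hp : 0 < p.toReal) (f : ℕ → ℝ) :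
    Memℓp f p ↔ ∑' n, ENNReal.ofReal (‖f n‖ ^ p.toReal) ≠ ∞ := by
  rw [memℓp_gen_iff hp]
  refine ⟨fun h => h.tsum_ofReal_ne_top, fun h => ?_⟩
  refine (ENNReal.summable_toReal h).congr fun n => ?_
  rw [ENNReal.toReal_ofReal (by positivity)]

theorem measurableSet_memℓp (hp : 0 < p.toReal) (lam : ℕ → ℝ) :
    MeasurableSet {N : ℕ → ℕ | Memℓp (fun n => lam n * (N n : ℝ)) p} := by
  simp only [memℓp_iff_tsum_ne_top hp]
  have : Measurable fun N : ℕ → ℕ =>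
      ∑' n, ENNReal.ofReal (‖lam n * (N n : ℝ)‖ ^ p.toReal) := by
    refine Measurable.tsum fun n => ?_
    exact (measurable_from_nat (f := fun k : ℕ =>
      ENNReal.ofReal (‖lam n * (k : ℝ)‖ ^ p.toReal))).comp (measurable_pi_apply n)
  exact (this (measurableSet_singleton ∞)).compl

/-- By Tonelli, `E ∑ |λ_n N_n|^p` is `∑ |λ_n|^p` times the `p`-th Poisson moment. -/
theorem ae_memℓp (hp : 0 < p.toReal) (hp2 : p.toReal ≤ 2) {lam : ℕ → ℝ} (hlam : Memℓp lam p) :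
    ∀ᵐ N ∂poissonSeqLaw, Memℓp (fun n => lam n * (N n : ℝ)) p := by
  have hm (n : ℕ) : Measurable fun k : ℕ => ENNReal.ofReal (‖lam n * (k : ℝ)‖ ^ p.toReal) :=
    measurable_from_nat
  have hm' (n : ℕ) : Measurable fun N : ℕ → ℕ =>
      ENNReal.ofReal (‖lam n * (N n : ℝ)‖ ^ p.toReal) := (hm n).comp (measurable_pi_apply n)
  have hC := (integrable_rpow_poissonMeasure hp hp2).lintegral_lt_top
  have hfin : ∫⁻ N, ∑' n, ENNReal.ofReal (‖lam n * (N n : ℝ)‖ ^ p.toReal) ∂poissonSeqLaw ≠ ∞ := by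
    rw [lintegral_tsum fun n => (hm' n).aemeasurable]
    have h1 (n : ℕ) : ∫⁻ N, ENNReal.ofReal (‖lam n * (N n : ℝ)‖ ^ p.toReal) ∂poissonSeqLaw =
        ENNReal.ofReal (‖lam n‖ ^ p.toReal) *
          ∫⁻ k : ℕ, ENNReal.ofReal ((k : ℝ) ^ p.toReal) ∂poissonMeasure 1 := by
      rw [(measurePreserving_eval_infinitePi (fun _ : ℕ => poissonMeasure 1) n).lintegral_comp
        (hm n), ← lintegral_const_mul _ measurable_from_nat]
      refine lintegral_congr fun k => ?_
      rw [← ENNReal.ofReal_mul (by positivity), norm_mul,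
        Real.mul_rpow (norm_nonneg _) (norm_nonneg _), Real.norm_of_nonneg (Nat.cast_nonneg k)]
    simp only [h1]
    rw [ENNReal.tsum_mul_right]
    exact ENNReal.mul_ne_top ((memℓp_iff_tsum_ne_top hp lam).1 hlam) hC.ne
  filter_upwards [ae_lt_top' (Measurable.tsum hm').aemeasurable hfin] with N hN
  exact (memℓp_iff_tsum_ne_top hp _).2 hN.ne

variable [Fact (1 ≤ p)]

theorem hasSum_weightedSeq (hp : p ≠ ∞) {lam : ℕ → ℝ} {N : ℕ → ℕ}
    (h : Memℓp (fun n => lam n * (N n : ℝ)) p) :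
    HasSum (fun n => (lam n * N n) • basisVec p n) (weightedSeq p lam N) := by
  simpa only [weightedSeq_apply h] using hasSum_smul_basisVec hp (weightedSeq p lam N)

theorem measurable_weightedSeq [MeasurableSpace (RealSeq p)] [BorelSpace (RealSeq p)]
    (hp : p ≠ ∞) (lam : ℕ → ℝ) : Measurable (weightedSeq p lam) := by
  have := secondCountableTopology_realSeq hp
  -- The indicator makes the partial sums converge to the default value `0` off the convergence set
  -- too.
  refine measurable_of_tendsto_metrizable (f := fun m =>
    {N : ℕ → ℕ | Memℓp (fun n => lam n * (N n : ℝ)) p}.indicator fun N =>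
      ∑ n ∈ Finset.range m, (lam n * N n) • basisVec p n) (fun m => ?_) ?_
  · refine Measurable.indicator ?_ (measurableSet_memℓp (toReal_pos_of_ne_top hp) lam)
    refine Finset.measurable_fun_sum _ fun n _ => ?_
    exact (measurable_from_nat (f := fun k : ℕ => (lam n * (k : ℝ)) • basisVec p n)).comp
      (measurable_pi_apply n)
  · refine tendsto_pi_nhds.2 fun N => ?_
    by_cases h : Memℓp (fun n => lam n * (N n : ℝ)) p
    · simpa [Set.indicator_apply, h] using (hasSum_weightedSeq hp h).tendsto_sum_nat
    · simp [h, weightedSeq]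

theorem integral_exp_poissonMeasure (t : ℝ) :
    ∫ k : ℕ, Complex.exp ((t * k : ℝ) * Complex.I) ∂poissonMeasure 1 =
      Complex.exp (Complex.exp (Complex.I * t) - 1) := by
  have h := charFun_map_cast_poissonMeasure 1 t
  rw [charFun_apply_real, integral_map .of_discrete (by fun_prop)] at h
  simpa [mul_comm] using h

theorem integral_exp_sum_poissonSeqLaw (t : ℕ → ℝ) (m : ℕ) :
    ∫ N, Complex.exp ((∑ n ∈ Finset.range m, t n * (N n : ℝ) : ℝ) * Complex.I) ∂poissonSeqLaw =
      Complex.exp (∑ n ∈ Finset.range m, (Complex.exp (Complex.I * t n) - 1)) := by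
  have hind : iIndepFun (fun (n : ℕ) (N : ℕ → ℕ) => N n) poissonSeqLaw :=
    iIndepFun_infinitePi (P := fun _ : ℕ => poissonMeasure 1)
      (X := fun (_ : ℕ) (k : ℕ) => k) fun _ => measurable_id
  have h := (hind.precomp (g := fun i : Fin m => (i : ℕ)) Fin.val_injective).integral_fun_prod_comp
    (f := fun (i : Fin m) (k : ℕ) => Complex.exp ((t i * k : ℝ) * Complex.I))
    (fun i => (measurable_pi_apply (i : ℕ)).aemeasurable)
    (fun i => measurable_from_nat.aestronglyMeasurable)
  have h1 (n : ℕ) : ∫ N : ℕ → ℕ, Complex.exp ((t n * (N n : ℝ) : ℝ) * Complex.I) ∂poissonSeqLaw =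
      Complex.exp (Complex.exp (Complex.I * t n) - 1) := by
    rw [← integral_exp_poissonMeasure,
      ← (measurePreserving_eval_infinitePi (fun _ : ℕ => poissonMeasure 1) n).map_eq,
      integral_map (measurable_pi_apply n).aemeasurable
        measurable_from_nat.aestronglyMeasurable]
  simp only [h1] at h
  rw [Complex.exp_sum, ← Fin.prod_univ_eq_prod_range
    (fun n => Complex.exp (Complex.exp (Complex.I * t n) - 1)), ← h]
  refine integral_congr_ae (ae_of_all _ fun N => ?_)
  simp only
  rw [← Complex.exp_sum, ← Finset.sum_range
    (fun n => ((t n * (N n : ℝ) : ℝ) : ℂ) * Complex.I), ← Finset.sum_mul, Complex.ofReal_sum]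

/-- Partial sums have explicit transforms by independence; dominated convergence with bound `1`
passes to the limit. -/
theorem charFunDual_map_weightedSeq [MeasurableSpace (RealSeq p)] [BorelSpace (RealSeq p)]
    (hp : p < 2) {lam : ℕ → ℝ} (hlam : Memℓp lam p) (x : StrongDual ℝ (RealSeq p)) :
    charFunDual (poissonSeqLaw.map (weightedSeq p lam)) x =
      Complex.exp (poissonExponent ⟨lam, hlam⟩ x) := by
  have hp' : p ≠ ∞ := (hp.trans ENNReal.ofNat_lt_top).ne
  have hp2 : p.toReal ≤ 2 := by simpa using ENNReal.toReal_mono (by simp) hp.le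
  have hZ := measurable_weightedSeq hp' lam
  rw [charFunDual_apply, integral_map hZ.aemeasurable (by fun_prop)]
  have hlim : Tendsto (fun m => ∫ N, Complex.exp ((∑ n ∈ Finset.range m,
      lam n * x (basisVec p n) * (N n : ℝ) : ℝ) * Complex.I) ∂poissonSeqLaw) atTop
      (𝓝 (∫ N, Complex.exp (x (weightedSeq p lam N) * Complex.I) ∂poissonSeqLaw)) := by
    refine tendsto_integral_of_dominated_convergence (fun _ => 1) (fun m => ?_)
      (integrable_const _) (fun m => ae_of_all _ fun N => ?_) ?_
    · refine Measurable.aestronglyMeasurable ?_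
      have : Measurable fun N : ℕ → ℕ => ∑ n ∈ Finset.range m,
          lam n * x (basisVec p n) * (N n : ℝ) :=
        Finset.measurable_fun_sum _ fun n _ => (measurable_from_nat (f := fun k : ℕ =>
          lam n * x (basisVec p n) * (k : ℝ))).comp (measurable_pi_apply n)
      fun_prop
    · rw [Complex.norm_exp_ofReal_mul_I]
    · filter_upwards [ae_memℓp (toReal_pos_of_ne_top hp') hp2 hlam] with N hN
      have h := ((hasSum_weightedSeq hp' hN).mapL x).tendsto_sum_nat
      have h' : Tendsto (fun m => ∑ n ∈ Finset.range m, lam n * x (basisVec p n) * (N n : ℝ)) atTop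
          (𝓝 (x (weightedSeq p lam N))) := by
        simpa [mul_right_comm] using h
      exact ((by fun_prop : Continuous fun s : ℝ =>
        Complex.exp (s * Complex.I)).tendsto _).comp h'
  refine tendsto_nhds_unique hlim ?_
  simp only [integral_exp_sum_poissonSeqLaw]
  exact (Complex.continuous_exp.tendsto _).comp
    (hasSum_poissonExponent hp' ⟨lam, hlam⟩ x).tendsto_sum_nat

end PoissonSeries

/-! ### Action of the weighted shift; the codifference bound. -/

section WeightedShift

variable {p : ℝ≥0∞} [Fact (1 ≤ p)] {ω lam : ℕ → ℝ} {hω : BddAbove (Set.range fun n => |ω n|)}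

theorem shiftCoeff_pos (hω_pos : ∀ n, 0 < ω n) {lam0 : ℝ} (hlam0 : 0 < lam0) (n : ℕ) :
    0 < shiftCoeff lam0 ω n :=
  mul_pos hlam0 (Finset.prod_pos fun l _ => one_div_pos.2 (hω_pos l))

theorem mul_shiftCoeff_succ (hω_pos : ∀ n, 0 < ω n) (lam0 : ℝ) (n : ℕ) :
    ω n * shiftCoeff lam0 ω (n + 1) = shiftCoeff lam0 ω n := by
  rw [shiftCoeff, shiftCoeff, Finset.prod_range_succ]
  have := (hω_pos n).ne'
  field_simp

theorem weightedBackwardShift_pow_basisVec_of_lt {n l : ℕ} (h : l < n) :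
    (weightedBackwardShift p ω hω ^ n) (basisVec p l) = 0 := by
  induction n generalizing l with
  | zero => omega
  | succ n ih =>
    rw [pow_succ, ContinuousLinearMap.mul_def, ContinuousLinearMap.comp_apply]
    rcases l with _ | l
    · rw [weightedBackwardShift_basisVec_zero, map_zero]
    · rw [weightedBackwardShift_basisVec_succ, map_smul, ih (by omega), smul_zero]

/-- `T` moves each atom `λ_{l+1} e_{l+1}` of the Lévy measure to the preceding one. -/
theorem smul_weightedBackwardShift_pow_basisVec (hrec : ∀ n, ω n * lam (n + 1) = lam n)
    (n l : ℕ) : lam (l + n) • (weightedBackwardShift p ω hω ^ n) (basisVec p (l + n)) =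
      lam l • basisVec p l := by
  induction n with
  | zero => simp
  | succ n ih =>
    rw [pow_succ, ContinuousLinearMap.mul_def, ContinuousLinearMap.comp_apply, ← add_assoc,
      weightedBackwardShift_basisVec_succ, map_smul, smul_smul, mul_comm, hrec, ih]

theorem summable_mul_shift_rpow (hp : p ≠ ∞) (hpos : ∀ n, 0 < lam n) (hlam : Memℓp lam p) (n : ℕ) :
    Summable fun l => (lam l * lam (l + n)) ^ (p.toReal / 2) := by
  have hs : Summable fun l => lam l ^ p.toReal := by
    simpa [Real.norm_of_nonneg (hpos _).le] using hlam.summable (toReal_pos_of_ne_top hp)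
  refine (hs.add ((summable_nat_add_iff n).2 hs)).of_nonneg_of_le
    (fun l => Real.rpow_nonneg (mul_pos (hpos _) (hpos _)).le _) fun l => ?_
  have hsq (k : ℕ) : lam k ^ p.toReal = (lam k ^ (p.toReal / 2)) ^ 2 := by
    rw [← Real.rpow_natCast, ← Real.rpow_mul (hpos k).le]
    norm_num
  rw [Real.mul_rpow (hpos _).le (hpos _).le, hsq, hsq]
  -- This is `uv ≤ u² + v²`.
  nlinarith [sq_nonneg (lam l ^ (p.toReal / 2) - lam (l + n) ^ (p.toReal / 2)),
    sq_nonneg (lam l ^ (p.toReal / 2)), sq_nonneg (lam (l + n) ^ (p.toReal / 2))]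

variable [MeasurableSpace (RealSeq p)]

theorem norm_codifference_le (hp : p < 2) (hpos : ∀ n, 0 < lam n) (hlam : Memℓp lam p)
    (hrec : ∀ n, ω n * lam (n + 1) = lam n) {μ : Measure (RealSeq p)}
    (hμ : ∀ x, charFunDual μ x = Complex.exp (poissonExponent ⟨lam, hlam⟩ x))
    (x y : StrongDual ℝ (RealSeq p)) (n : ℕ) :
    ‖codifference μ x (y.comp (weightedBackwardShift p ω hω ^ n))‖ ≤
      2 ^ (2 - p.toReal) * (∑' l, (lam l * lam (l + n)) ^ (p.toReal / 2)) *
        (‖x‖ ^ (p.toReal / 2) * ‖y‖ ^ (p.toReal / 2)) := by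
  have hp' : p ≠ ∞ := (hp.trans ENNReal.ofNat_lt_top).ne
  have hp2 : p.toReal ≤ 2 := by simpa using ENNReal.toReal_mono (by simp) hp.le
  have hp0 := toReal_pos_of_ne_top hp'
  have h := hasSum_codifference hp' hμ x (y.comp (weightedBackwardShift p ω hω ^ n))
  -- The first `n` terms vanish since `T^n e_l = 0` for `l < n`.
  rw [← hasSum_nat_add_iff' n, Finset.sum_eq_zero, sub_zero] at h
  swap
  · intro l hl
    simp [weightedBackwardShift_pow_basisVec_of_lt (Finset.mem_range.1 hl)]
  rw [← h.tsum_eq, ← tsum_mul_left, ← tsum_mul_right]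
  have hs := ((summable_mul_shift_rpow hp' hpos hlam n).mul_left
    ((2 : ℝ) ^ (2 - p.toReal))).mul_right (‖x‖ ^ (p.toReal / 2) * ‖y‖ ^ (p.toReal / 2))
  refine tsum_of_norm_bounded hs.hasSum fun l => ?_
  have hy : lam (l + n) * (-(y.comp (weightedBackwardShift p ω hω ^ n))) (basisVec p (l + n)) =
      -(lam l * y (basisVec p l)) := by
    have := congrArg y (smul_weightedBackwardShift_pow_basisVec (p := p) (hω := hω) hrec n l)
    rw [map_smul, map_smul, smul_eq_mul, smul_eq_mul] at this
    rw [neg_apply, mul_neg, ← this]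
    rfl
  have hbound (z : StrongDual ℝ (RealSeq p)) (k : ℕ) :
      |lam k * z (basisVec p k)| ^ (p.toReal / 2) ≤
        lam k ^ (p.toReal / 2) * ‖z‖ ^ (p.toReal / 2) := by
    rw [← Real.mul_rpow (hpos k).le (norm_nonneg _), abs_mul, abs_of_pos (hpos k)]
    have := abs_apply_basisVec_le z k
    have := (hpos k).le
    gcongr
  change ‖(Complex.exp (Complex.I * (lam (l + n) * x (basisVec p (l + n)) : ℝ)) - 1) *
    (Complex.exp (Complex.I * (lam (l + n) *
      (-(y.comp (weightedBackwardShift p ω hω ^ n))) (basisVec p (l + n)) : ℝ)) - 1)‖ ≤ _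
  rw [hy, norm_mul]
  -- Each of the two factors is interpolated with exponent `p/2` and contributes `2^{1-p/2}`.
  have hpow : (2 : ℝ) ^ (2 - p.toReal) = 2 ^ (1 - p.toReal / 2) * 2 ^ (1 - p.toReal / 2) := by
    rw [← Real.rpow_add two_pos]
    ring_nf
  calc _ ≤ (2 ^ (1 - p.toReal / 2) * |lam (l + n) * x (basisVec p (l + n))| ^ (p.toReal / 2)) *
        (2 ^ (1 - p.toReal / 2) * |-(lam l * y (basisVec p l))| ^ (p.toReal / 2)) := by
        gcongr <;> exact norm_exp_sub_one_le_rpow (by linarith) (by linarith) _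
    _ ≤ (2 ^ (1 - p.toReal / 2) * (lam (l + n) ^ (p.toReal / 2) * ‖x‖ ^ (p.toReal / 2))) *
        (2 ^ (1 - p.toReal / 2) * (lam l ^ (p.toReal / 2) * ‖y‖ ^ (p.toReal / 2))) := by
        rw [abs_neg]
        have := hbound x (l + n)
        have := hbound y l
        have := Real.rpow_nonneg (hpos (l + n)).le (p.toReal / 2)
        gcongr
    _ = _ := by
        rw [Real.mul_rpow (hpos _).le (hpos _).le, hpow]
        ring

/-- On the compound Poisson law the weighted shift is a factor of a Bernoulli shift, since it maps
`∑ n, λ_n N_n e_n` to `∑ n, λ_n N_{n+1} e_n`. Mixing thus needs no decay of the codifferences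
beyond what `λ ∈ ℓ^p` gives. -/
theorem isMixing_weightedBackwardShift [BorelSpace (RealSeq p)] (hp : p < 2)
    (hlam : Memℓp lam p) (hrec : ∀ n, ω n * lam (n + 1) = lam n) :
    IsMixing (weightedBackwardShift p ω hω) (poissonSeqLaw.map (weightedSeq p lam)) := by
  have hp' : p ≠ ∞ := (hp.trans ENNReal.ofNat_lt_top).ne
  have hp2 : p.toReal ≤ 2 := by simpa using ENNReal.toReal_mono (by simp) hp.le
  have hae := ae_memℓp (toReal_pos_of_ne_top hp') hp2 hlam
  have hshift := isMixing_seqShift (ProbabilityTheory.poissonMeasure 1)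
  refine hshift.map (weightedBackwardShift p ω hω).measurable (measurable_weightedSeq hp' lam) ?_
  filter_upwards [hae, hshift.1.quasiMeasurePreserving.ae hae] with N h1 h2
  ext n
  rw [weightedBackwardShift_apply, weightedSeq_apply h1, weightedSeq_apply h2, ← mul_assoc, hrec]
  rfl

end WeightedShift

/-! ### The main theorem. -/

theorem proposition4p3 (p : ℝ≥0∞) [Fact (1 ≤ p)] (hp : p < 2)
    [MeasurableSpace (RealSeq p)] [BorelSpace (RealSeq p)]
    (ω : ℕ → ℝ) (hω_pos : ∀ n, 0 < ω n) (hω_bdd : BddAbove (Set.range fun n => |ω n|))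
    (lam0 : ℝ) (hlam0 : 0 < lam0) (hlam : Memℓp (shiftCoeff lam0 ω) p) :
    -- the compound Poisson measure is well defined
    (∃! μ : Measure (RealSeq p), IsCompoundPoisson p (shiftCoeff lam0 ω) hlam μ) ∧
    ∀ μ : Measure (RealSeq p), IsCompoundPoisson p (shiftCoeff lam0 ω) hlam μ →
      -- its characteristic functional has a logarithm, so that codifferences are well defined
      IsLogCharFun μ (logCharFun μ) ∧
      -- invariance
      MeasurePreserving (weightedBackwardShift p ω hω_bdd) μ μ ∧
      -- codifference bound, with `T^{*n} y = y ∘ T^n`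
      (∀ n : ℕ,
        Summable (fun l : ℕ =>
          (shiftCoeff lam0 ω l * shiftCoeff lam0 ω (l + n)) ^ (p.toReal / 2)) ∧
        (⨆ (x : StrongDual ℝ (RealSeq p)) (_ : x ≠ 0)
            (y : StrongDual ℝ (RealSeq p)) (_ : y ≠ 0),
          ((‖codifference μ x (y.comp (weightedBackwardShift p ω hω_bdd ^ n))‖ /
            (‖x‖ ^ (p.toReal / 2) * ‖y‖ ^ (p.toReal / 2)) : ℝ) : EReal)) ≤
        (((2 : ℝ) ^ (4 - p.toReal) * ∑' l : ℕ,
          (shiftCoeff lam0 ω l * shiftCoeff lam0 ω (l + n)) ^ (p.toReal / 2) : ℝ) : EReal)) ∧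
      -- mixing
      (Tendsto (fun n : ℕ => ∑' l : ℕ,
          (shiftCoeff lam0 ω l * shiftCoeff lam0 ω (l + n)) ^ (p.toReal / 2)) atTop (𝓝 0) →
        IsMixing (weightedBackwardShift p ω hω_bdd) μ) := by
  have hp' : p ≠ ∞ := (hp.trans ENNReal.ofNat_lt_top).ne
  have := secondCountableTopology_realSeq hp'
  have hpos := shiftCoeff_pos hω_pos hlam0
  have hrec := mul_shiftCoeff_succ hω_pos lam0
  set lam := shiftCoeff lam0 ω
  have hZ := measurable_weightedSeq hp' lam
  have hchar := charFunDual_map_weightedSeq hp hlam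
  have hprob : IsProbabilityMeasure (poissonSeqLaw.map (weightedSeq p lam)) :=
    Measure.isProbabilityMeasure_map hZ.aemeasurable
  have huniq (μ : Measure (RealSeq p)) (hμ : IsCompoundPoisson p lam hlam μ) :
      μ = poissonSeqLaw.map (weightedSeq p lam) := by
    obtain ⟨h1, h2⟩ := (isCompoundPoisson_iff hp' hlam hpos μ).1 hμ
    exact Measure.ext_of_charFunDual (funext fun x => (h2 x).trans (hchar x).symm)
  refine ⟨⟨_, (isCompoundPoisson_iff hp' hlam hpos _).2 ⟨hprob, hchar⟩, huniq⟩, ?_⟩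
  intro μ hμ
  rw [huniq μ hμ]
  have hmix : IsMixing (weightedBackwardShift p ω hω_bdd)
      (poissonSeqLaw.map (weightedSeq p lam)) := isMixing_weightedBackwardShift hp hlam hrec
  refine ⟨isLogCharFun_logCharFun (isLogCharFun_poissonExponent hp' hchar), hmix.1, fun n => ?_,
    fun _ => hmix⟩
  refine ⟨summable_mul_shift_rpow hp' hpos hlam n, ?_⟩
  refine iSup₂_le fun x hx => iSup₂_le fun y hy => EReal.coe_le_coe_iff.2 ?_
  have hx' := norm_pos_iff.2 hx
  have hy' := norm_pos_iff.2 hy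
  rw [div_le_iff₀ (by positivity)]
  refine (norm_codifference_le hp hpos hlam hrec hchar x y n).trans ?_
  have hsum : 0 ≤ ∑' l, (lam l * lam (l + n)) ^ (p.toReal / 2) :=
    tsum_nonneg fun l => Real.rpow_nonneg (mul_pos (hpos _) (hpos _)).le _
  -- Here `2^{2-p}` is weakened to `2^{4-p}`.
  gcongr <;> norm_num
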